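/- **Theorem (Fundamental Theorem of Calculus, part 2).** Let $E$ be a Dedekind complete $\Phi$-algebra, that is, a Dedekind complete real $f$-algebra with a multiplicative unit. For a band $B$ of $E$ let $\mathbb P_B$ be the band projection onto $B$. Write $a\ll b$ if $b-a$ is a weak order unit of $E$, and put $[a,b]=\{x: a\le x\le b\}$ for $a\le b$ and $(a,b)=\{x: a\ll x\ll b\}$ for $a\ll b$. Write $\Delta\downarrow 0$ if $\Delta\subseteq E$ is nonempty, downward directed and has infimum $0$, and $\mathcal E\searrow 0$ if $\mathcal E\subseteq E$ has infimum $0$ (not necessarily directed). *Functions.* Consider a function $g\colon D\to E$ with $D\subseteq E$. - $g$ is *locally band preserving* if for every band $B$ and all $x,y\in D$, $\mathbb P_B x=\mathbb P_B y$ implies $\mathbb P_B g(x)=\mathbb P_B g(y)$. - A net $(x_\alpha)$ in $E$ *converges* to $x\in E$ if there is $\mathcal E\searrow 0$ such that for every $\varepsilon\in\mathcal E$ there is $\alpha_0$ with $|x_\alpha-x|\le\varepsilon$ for all $\alpha\ge\alpha_0$. The function $g$ is *order continuous* if $x_\alpha\to c$ with $x_\alpha,c\in D$ implies $g(x_\alpha)\to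 g(c)$. - $g$ is *order differentiable at $c\in D$ with derivative $g'(c)\in E$* if there is a weak order unit $r$ of $E$ with $(c-r,c+r)\subseteq D$ such that for every $\Delta\downarrow 0$ there is $\mathcal E\searrow 0$ such that for every $\varepsilon\in\mathcal E$ there is $\delta\in\Delta$ with $$x\in(c-r,c+r),\ |x-c|\le\delta\ \Longrightarrow\ |g(x)-g(c)-(x-c)g'(c)|\le|x-c|\,\varepsilon .$$ *Integral.* Let $f\colon[u,v]\to E$ be order bounded, where $u\le v$. For a finite chain $P=\{u=x_0\le x_1\le\dots\le x_n=v\}$ let $$L(f,P)=\sum_{i=1}^n \Big(\inf_{[x_{i-1},x_i]}f\Big)(x_i-x_{i-1}),\qquad U(f,P)=\sum_{i=1}^n \Big(\sup_{[x_{i-1},x_i]}f\Big)(x_i-x_{i-1}).$$ The function $f$ is *integrable* on $[u,v]$ if $\sup_P L(f,P)=\inf_P U(f,P)$, and this common value is then $\int_u^v f(z)\,dz$. For arbitrary $x,y\in E$ let $B_{x<y}$ be the largest band $B$ for which $\mathbb P_B(y-x)$ is a weak order unit of $B$. If $f$ is order bounded, locally band preserving and integrable on $[x\wedge y,x\vee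 y]$, put $$\int_x^y f(z)\,dz:=\mathbb P_{B_{x<y}}\Big(\int_{x\wedge y}^{x\vee y}f(z)\,dz\Big)-\mathbb P_{B_{y<x}}\Big(\int_{x\wedge y}^{x\vee y}f(z)\,dz\Big).$$ *Claim.* Let $a\ll b$ in $E$, let $f\colon[a,b]\to E$ be order bounded and locally band preserving, and let $F\colon[a,b]\to E$ be locally band preserving, order continuous on $[a,b]$, and order differentiable at every $c\in(a,b)$ with $F'(c)=f(c)$. If $f$ is integrable on $[a,b]$, then for all $x,y\in[a,b]$, comparable or not, $f$ is integrable on $[x\wedge y,x\vee y]$ and $$\int_x^y f(z)\,dz=F(y)-F(x).$$ -/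

import Mathlib

universe u

noncomputable section

namespace PhiAlgebra

/-- The two axioms that turn an ordered real algebra on a vector lattice into an `f`-algebra:
products of positive elements are positive, and multiplication by a positive element (on either
side) preserves disjointness. A `Φ`-algebra is an `f`-algebra with a multiplicative unit; the unit
is the `1` of the ring structure. Commutativity is not assumed. -/
class IsFAlgebra (E : Type u) [Ring E] [Lattice E] : Prop where
  mul_nonneg' : ∀ x y : E, 0 ≤ x → 0 ≤ y → 0 ≤ x * y
  mul_disjoint : ∀ x y z : E, x ⊓ y = 0 → 0 ≤ z → (z * x) ⊓ y = 0
  disjoint_mul : ∀ x y z : E, x ⊓ y = 0 → 0 ≤ z → (x * z) ⊓ y = 0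

section VectorLattice

variable {E : Type u} [AddCommGroup E] [ConditionallyCompleteLattice E] [Module ℝ E]

/-- A band: a solid linear subspace that is closed under all suprema existing in `E`. -/
def IsBand (B : Submodule ℝ E) : Prop :=
  (∀ x ∈ B, ∀ y : E, |y| ≤ |x| → y ∈ B) ∧
    ∀ S : Set E, S ⊆ (B : Set E) → ∀ s : E, IsLUB S s → s ∈ B

/-- The projection onto a band `B` of a Dedekind complete vector lattice: on positive `x` it is
`sup {z ∈ B : 0 ≤ z ≤ x}`, extended to all of `E` by `x = x⁺ - x⁻`. -/
def bandProj (B : Submodule ℝ E) (x : E) : E :=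
  sSup {z : E | z ∈ B ∧ 0 ≤ z ∧ z ≤ x ⊔ 0} - sSup {z : E | z ∈ B ∧ 0 ≤ z ∧ z ≤ (-x) ⊔ 0}

/-- `w` is a weak order unit of the band `B` (as a vector lattice in its own right). -/
def IsWeakOrderUnitOf (B : Submodule ℝ E) (w : E) : Prop :=
  w ∈ B ∧ 0 ≤ w ∧ ∀ z ∈ B, |z| ⊓ w = 0 → z = 0

/-- `x ≪ y`: the difference `y - x` is a weak order unit of `E`. -/
def WayLT (x y : E) : Prop := IsWeakOrderUnitOf (⊤ : Submodule ℝ E) (y - x)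

/-- The order open interval `(a, b) = {x : a ≪ x ≪ b}`. -/
def openInterval (a b : E) : Set E := {x | WayLT a x ∧ WayLT x b}

/-- The band `B_{x < y}`: the largest band `B` such that the projection of `y - x` to `B` is a weak
order unit of `B`, written as the supremum of all bands with this property. -/
def bandLT (x y : E) : Submodule ℝ E :=
  sSup {B : Submodule ℝ E | IsBand B ∧ IsWeakOrderUnitOf B (bandProj B (y - x))}

/-- The function `f` with domain `D` is locally band preserving. -/
def LocallyBandPreservingOn (f : E → E) (D : Set E) : Prop :=
  ∀ B : Submodule ℝ E, IsBand B → ∀ x ∈ D, ∀ y ∈ D,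
    bandProj B x = bandProj B y → bandProj B (f x) = bandProj B (f y)

/-- The function `f` with domain `D` is order bounded: its range lies in an order interval. -/
def OrderBoundedOn (f : E → E) (D : Set E) : Prop :=
  ∃ m M : E, ∀ x ∈ D, m ≤ f x ∧ f x ≤ M

/-- Order convergence of a net: the set `Eps` has infimum `0` (it need not be directed) and every
`ε ∈ Eps` eventually dominates `|x α - l|`. -/
def OrderTendsto {ι : Type u} [Preorder ι] (x : ι → E) (l : E) : Prop :=
  ∃ Eps : Set E, IsGLB Eps 0 ∧ ∀ ε ∈ Eps, ∃ α₀ : ι, ∀ α, α₀ ≤ α → |x α - l| ≤ ε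

/-- The function `f` with domain `D` is order continuous: it preserves the order limits of nets
in `D` that converge to a point of `D`. -/
def OrderContinuousOn (f : E → E) (D : Set E) : Prop :=
  ∀ c ∈ D, ∀ (ι : Type u) [Preorder ι] [IsDirectedOrder ι] [Nonempty ι] (x : ι → E),
    (∀ α, x α ∈ D) → OrderTendsto x c → OrderTendsto (fun α => f (x α)) (f c)

/-- A partition `a = x₀ ≤ x₁ ≤ ⋯ ≤ xₙ = b` of the order interval `[a, b]`. -/
structure OrderPartition (a b : E) where
  /-- the number of subintervals -/
  n : ℕ
  /-- the partition points -/
  pt : Fin (n + 1) → E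
  mono : Monotone pt
  first : pt 0 = a
  last : pt (Fin.last n) = b

end VectorLattice

section Algebra

variable {E : Type u} [Ring E] [ConditionallyCompleteLattice E]

/-- The lower Darboux sum `∑ m_i (x_i - x_{i-1})` with `m_i = inf f([x_{i-1}, x_i])`. -/
def lowerSum (f : E → E) {a b : E} (P : OrderPartition a b) : E :=
  ∑ i : Fin P.n, sInf (f '' Set.Icc (P.pt i.castSucc) (P.pt i.succ)) *
    (P.pt i.succ - P.pt i.castSucc)

/-- The upper Darboux sum `∑ M_i (x_i - x_{i-1})` with `M_i = sup f([x_{i-1}, x_i])`. -/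
def upperSum (f : E → E) {a b : E} (P : OrderPartition a b) : E :=
  ∑ i : Fin P.n, sSup (f '' Set.Icc (P.pt i.castSucc) (P.pt i.succ)) *
    (P.pt i.succ - P.pt i.castSucc)

/-- The lower integral over `[a, b]`. -/
def lowerIntegral (f : E → E) (a b : E) : E :=
  sSup (Set.range fun P : OrderPartition a b => lowerSum f P)

/-- The upper integral over `[a, b]`. -/
def upperIntegral (f : E → E) (a b : E) : E :=
  sInf (Set.range fun P : OrderPartition a b => upperSum f P)

/-- Darboux integrability of `f` on the order interval `[a, b]` (used for `a ≤ b`): `f` is order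
bounded there and its upper and lower integrals agree. -/
def DarbouxIntegrable (f : E → E) (a b : E) : Prop :=
  OrderBoundedOn f (Set.Icc a b) ∧ upperIntegral f a b = lowerIntegral f a b

/-- The Darboux integral over `[a, b]`, for `a ≤ b` and `f` integrable on `[a, b]`: the common value
of the lower and the upper integral. -/
def darbouxIntegral (f : E → E) (a b : E) : E := lowerIntegral f a b

/-- Integrability from `x` to `y`, for arbitrary `x` and `y`. -/
def IntegrableFromTo (f : E → E) (x y : E) : Prop := DarbouxIntegrable f (x ⊓ y) (x ⊔ y)

variable [Algebra ℝ E]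

/-- The integral from `x` to `y`, for arbitrary, possibly incomparable, `x` and `y`. -/
def integralFromTo (f : E → E) (x y : E) : E :=
  bandProj (bandLT x y) (darbouxIntegral f (x ⊓ y) (x ⊔ y)) -
    bandProj (bandLT y x) (darbouxIntegral f (x ⊓ y) (x ⊔ y))

/-- The function `F` with domain `D` is order differentiable at `c` with order derivative `d`. -/
def HasOrderDerivAt (F : E → E) (D : Set E) (c d : E) : Prop :=
  ∃ r : E, WayLT 0 r ∧ openInterval (c - r) (c + r) ⊆ D ∧
    ∀ Δ : Set E, Δ.Nonempty → DirectedOn (· ≥ ·) Δ → IsGLB Δ 0 →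
      ∃ Eps : Set E, IsGLB Eps 0 ∧ ∀ ε ∈ Eps, ∃ δ ∈ Δ,
        ∀ x ∈ openInterval (c - r) (c + r), |x - c| ≤ δ →
          |F x - F c - (x - c) * d| ≤ |x - c| * ε

end Algebra

end PhiAlgebra

end

open PhiAlgebra

set_option linter.unusedSectionVars false

/-! `E` is commutative, and each of its band projections is multiplication by an idempotent `e`. So
"locally band preserving" says that `e * x = e * y` forces `e * f x = e * f y`, and one can argue
band by band, almost as on the real line.

The core is the mean value inequality `IsOrderPrimitive.sub_le_mul`: an upper bound `M` of `f` on
`[u, v]` gives `F v - F u ≤ M * (v - u)`. With `M` enlarged by `η > 0`, the points of `[u, v]` up to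
which this holds have a greatest element `s`; the derivative at `s` would let `s` advance on any
band where `s < v`, so `s = v`. Telescoping over a partition, for `F` and for `-F`, puts `F v - F u`
between the lower and the upper integral, which settles `[a, b]`.

For `[u, v] ⊆ [a, b]`, clamping a partition of `[a, b]` splits its upper sum into three
(`upperSum_clamp_le`). Incomparable `x`, `y` are treated on three complementary bands, where `x <
y`, `y < x` and `x = y`. -/

namespace PhiAlgebra

/-! ### Disjointness and products in an `f`-algebra. -/

section OrderedRing

variable {E : Type u} [Ring E] [Lattice E] [IsOrderedAddMonoid E] [IsFAlgebra E]

theorem mul_eq_zero_of_inf_eq_zero {x y : E} (h : x ⊓ y = 0) : x * y = 0 := by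
  have hx : 0 ≤ x := h ▸ inf_le_left
  have hy : 0 ≤ y := h ▸ inf_le_right
  have h1 := IsFAlgebra.disjoint_mul x y y h hy
  have h2 := IsFAlgebra.mul_disjoint y (x * y) x (by rwa [inf_comm]) hx
  rwa [inf_idem] at h2

theorem mul_self_nonneg_of_lattice (x : E) : 0 ≤ x * x := by
  have h1 : x⁺ * x⁻ = 0 := mul_eq_zero_of_inf_eq_zero (posPart_inf_negPart_eq_zero x)
  have h2 : x⁻ * x⁺ = 0 :=
    mul_eq_zero_of_inf_eq_zero (by rw [inf_comm]; exact posPart_inf_negPart_eq_zero x)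
  have h3 : x * x = x⁺ * x⁺ + x⁻ * x⁻ := by
    conv_lhs => rw [← posPart_sub_negPart x]
    rw [sub_mul, mul_sub, mul_sub, h1, h2]
    abel
  rw [h3]
  exact add_nonneg (IsFAlgebra.mul_nonneg' _ _ (posPart_nonneg x) (posPart_nonneg x))
    (IsFAlgebra.mul_nonneg' _ _ (negPart_nonneg x) (negPart_nonneg x))

instance isOrderedRing : IsOrderedRing E where
  zero_le_one := by simpa using mul_self_nonneg_of_lattice (1 : E)
  mul_le_mul_of_nonneg_left a ha b c hbc := by
    have := IsFAlgebra.mul_nonneg' a (c - b) ha (sub_nonneg.2 hbc)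
    rwa [mul_sub, sub_nonneg] at this
  mul_le_mul_of_nonneg_right a ha b c hbc := by
    have := IsFAlgebra.mul_nonneg' (c - b) a (sub_nonneg.2 hbc) ha
    rwa [sub_mul, sub_nonneg] at this

theorem add_inf_le_add_inf {x y z : E} (hx : 0 ≤ x) (hy : 0 ≤ y) (hz : 0 ≤ z) :
    (x + y) ⊓ z ≤ x ⊓ z + y ⊓ z := by
  rw [inf_add, add_inf, add_inf]
  refine le_inf (le_inf inf_le_left ?_) (le_inf ?_ ?_) <;> refine inf_le_right.trans ?_
  · exact le_add_of_nonneg_left hx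
  · exact le_add_of_nonneg_right hy
  · exact le_add_of_nonneg_left hz

theorem add_inf_eq_zero {x y z : E} (hx : x ⊓ z = 0) (hy : y ⊓ z = 0) : (x + y) ⊓ z = 0 := by
  have hx0 : 0 ≤ x := hx ▸ inf_le_left
  have hy0 : 0 ≤ y := hy ▸ inf_le_left
  have hz0 : 0 ≤ z := hy ▸ inf_le_right
  refine le_antisymm ?_ (le_inf (add_nonneg hx0 hy0) hz0)
  simpa [hx, hy] using add_inf_le_add_inf hx0 hy0 hz0

/-- The map `z ↦ z * y + y * z` preserves disjointness, hence infima: `p - p ⊓ q` and `q - p ⊓ q`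
have disjoint images. -/
theorem le_inf_mul_add_mul_inf {w p q y : E} (hy : 0 ≤ y) (hp : w ≤ p * y + y * p)
    (hq : w ≤ q * y + y * q) : w ≤ (p ⊓ q) * y + y * (p ⊓ q) := by
  have h0 : (p - p ⊓ q) ⊓ (q - p ⊓ q) = 0 := by rw [← inf_sub]; exact sub_self _
  have hp' : ((p - p ⊓ q) * y + y * (p - p ⊓ q)) ⊓ (q - p ⊓ q) = 0 :=
    add_inf_eq_zero (IsFAlgebra.disjoint_mul _ _ _ h0 hy) (IsFAlgebra.mul_disjoint _ _ _ h0 hy)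
  rw [inf_comm] at hp'
  have h1 : ((q - p ⊓ q) * y + y * (q - p ⊓ q)) ⊓ ((p - p ⊓ q) * y + y * (p - p ⊓ q)) = 0 :=
    add_inf_eq_zero (IsFAlgebra.disjoint_mul _ _ _ hp' hy) (IsFAlgebra.mul_disjoint _ _ _ hp' hy)
  rw [← sub_nonpos, ← h1]
  refine le_inf ?_ ?_ <;> rw [← sub_nonneg]
  · convert sub_nonneg.2 hq using 1; noncomm_ring
  · convert sub_nonneg.2 hp using 1; noncomm_ring

end OrderedRing

/-! ### The Archimedean property, from Dedekind completeness. -/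

section Archimedean

variable {E : Type u} [AddCommGroup E] [ConditionallyCompleteLattice E] [IsOrderedAddMonoid E]
  [Module ℝ E] [PosSMulMono ℝ E]

theorem nonpos_of_forall_nat_smul_le {x y : E} (h : ∀ n : ℕ, (n + 1) • x ≤ y) : x ≤ 0 := by
  set S := Set.range fun n : ℕ => (n + 1) • x
  have hS : BddAbove S := ⟨y, by rintro _ ⟨n, rfl⟩; exact h n⟩
  have h1 : sSup S ≤ sSup S - x := by
    refine csSup_le (Set.range_nonempty _) ?_
    rintro _ ⟨n, rfl⟩
    rw [le_sub_iff_add_le]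
    refine le_csSup hS ⟨n + 1, ?_⟩
    simp only [succ_nsmul]
  simpa using h1

theorem nonpos_of_forall_le_smul {x y : E} (h : ∀ t : ℝ, 0 < t → x ≤ t • y) : x ≤ 0 := by
  refine nonpos_of_forall_nat_smul_le (y := y) fun n => ?_
  have hn : (0 : ℝ) < n + 1 := by positivity
  have h1 := smul_le_smul_of_nonneg_left (h (1 / (n + 1)) (by positivity)) hn.le
  rw [smul_smul, mul_one_div_cancel hn.ne', one_smul] at h1
  convert h1 using 1
  rw [← Nat.cast_smul_eq_nsmul ℝ]
  push_cast
  rfl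

theorem le_of_forall_le_add_smul {x y z : E} (h : ∀ t : ℝ, 0 < t → x ≤ y + t • z) : x ≤ y :=
  sub_nonpos.1 <| nonpos_of_forall_le_smul (y := z) fun t ht =>
    sub_le_iff_le_add'.2 (h t ht)

theorem smul_le_smul_right_of_nonneg {s t : ℝ} (h : s ≤ t) {x : E} (hx : 0 ≤ x) :
    s • x ≤ t • x := by
  rw [← sub_nonneg, ← sub_smul]
  exact smul_nonneg (sub_nonneg.2 h) hx

end Archimedean

/-! ### Commutativity of the multiplication. -/

section Commutative

variable {E : Type u} [Ring E] [ConditionallyCompleteLattice E] [IsOrderedAddMonoid E]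
  [Algebra ℝ E] [PosSMulMono ℝ E] [IsFAlgebra E]

/-- Expand `(x - 2t)² ≥ 0` and divide by `4t`. This trades an unbounded `x` for a multiple of `1`
plus a small multiple of `x²`. -/
theorem le_smul_one_add_smul_mul_self (x : E) {t : ℝ} (ht : 0 < t) :
    x ≤ t • (1 : E) + (1 / (4 * t)) • (x * x) := by
  have h := smul_nonneg (a := 1 / (4 * t)) (by positivity)
    (mul_self_nonneg_of_lattice (x - (2 * t) • (1 : E)))
  rw [← sub_nonneg]
  convert h using 1
  simp only [sub_mul, mul_sub, smul_mul_assoc, mul_smul_comm, one_mul, mul_one]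
  match_scalars <;> field_simp <;> norm_num

theorem posPart_sub_smul_le (x : E) {t : ℝ} (ht : 0 < t) :
    (x - t • (1 : E))⁺ ≤ (1 / (4 * t)) • (x * x) := by
  refine sup_le (sub_le_iff_le_add'.2 (le_smul_one_add_smul_mul_self x ht)) ?_
  exact smul_nonneg (by positivity) (mul_self_nonneg_of_lattice x)

theorem abs_commutator_le {x y : E} (hy : 0 ≤ y) :
    |x * y - y * x| ≤ |x| * y + y * |x| := by
  refine sup_le ?_ ?_
  · rw [sub_eq_add_neg, ← mul_neg]
    exact add_le_add (mul_le_mul_of_nonneg_right (le_abs_self x) hy)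
      (mul_le_mul_of_nonneg_left (neg_le_abs x) hy)
  · rw [neg_sub, sub_eq_neg_add, ← neg_mul]
    exact add_le_add (mul_le_mul_of_nonneg_right (neg_le_abs x) hy)
      (mul_le_mul_of_nonneg_left (le_abs_self x) hy)

theorem add_posPart_inf_abs_sub_le {y c : E} (hc : 0 ≤ c) :
    (c + y⁺) ⊓ |y - c| ≤ c + (y - c)⁺ := by
  let _ : DistribLattice E := AddCommGroup.toDistribLattice E
  have h : |y - c| = (y - c) ⊔ (c - y) := by rw [abs, neg_sub]
  rw [h, inf_sup_left]
  refine sup_le (inf_le_right.trans ((le_posPart _).trans (le_add_of_nonneg_left hc))) ?_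
  refine le_trans ?_ (le_add_of_nonneg_right (posPart_nonneg _))
  rw [sub_eq_add_neg, ← add_inf]
  refine (add_le_add_right ?_ c).trans (add_zero c).le
  rw [← posPart_inf_negPart_eq_zero y]
  exact inf_le_inf_left _ (neg_le_negPart y)

/-- Shifting `x` by a multiple of `1` leaves the commutator unchanged, so it is bounded through each
`|x - j c|`, and then through their infimum. On the grid `0, c, …, m c` that infimum is at most `c`
plus the overshoot `(x - m c)⁺`. -/
theorem abs_commutator_le_of_nonneg {x y : E} (hx : 0 ≤ x) (hy : 0 ≤ y) {c : ℝ} (hc : 0 ≤ c)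
    (m : ℕ) : |x * y - y * x| ≤ (c • (1 : E) + (x - (m * c) • (1 : E))⁺) * y +
      y * (c • (1 : E) + (x - (m * c) • (1 : E))⁺) := by
  have hc1 : 0 ≤ c • (1 : E) := smul_nonneg hc zero_le_one
  induction m with
  | zero =>
    have h : |x| ≤ c • (1 : E) + (x - ((0 : ℕ) * c) • (1 : E))⁺ := by
      simpa [posPart_of_nonneg hx, abs_of_nonneg hx] using hc1
    exact (abs_commutator_le hy).trans
      (add_le_add (mul_le_mul_of_nonneg_right h hy) (mul_le_mul_of_nonneg_left h hy))
  | succ m ih =>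
    set z := x - (m * c) • (1 : E) with hz
    have hz' : x - ((m + 1 : ℕ) * c) • (1 : E) = z - c • (1 : E) := by
      rw [hz]; push_cast; module
    have hcomm : x * y - y * x = (z - c • (1 : E)) * y - y * (z - c • (1 : E)) := by
      simp only [hz, sub_mul, mul_sub, smul_mul_assoc, mul_smul_comm, one_mul, mul_one]
      abel
    have h1 : |x * y - y * x| ≤ |z - c • (1 : E)| * y + y * |z - c • (1 : E)| := by
      rw [hcomm]; exact abs_commutator_le hy
    have h2 := le_inf_mul_add_mul_inf hy ih h1
    have h3 := add_posPart_inf_abs_sub_le (y := z) hc1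
    rw [hz']
    exact h2.trans
      (add_le_add (mul_le_mul_of_nonneg_right h3 hy) (mul_le_mul_of_nonneg_left h3 hy))

theorem mul_comm_of_nonneg {x y : E} (hx : 0 ≤ x) (hy : 0 ≤ y) : x * y = y * x := by
  have h : |x * y - y * x| ≤ 0 := by
    refine nonpos_of_forall_le_smul (y := y + y) fun c hc => ?_
    refine le_of_forall_le_add_smul (z := x * x * y + y * (x * x)) fun t ht => ?_
    -- The overshoot is at most `x² / (4 m c)`; this `m` makes the coefficient at most `t`.
    obtain ⟨m, hm⟩ := exists_nat_gt (1 / (4 * c * t))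
    have hm0 : (0 : ℝ) < m := lt_trans (by positivity) hm
    have hmc : 1 / (4 * (m * c)) ≤ t := by
      rw [div_lt_iff₀ (by positivity)] at hm
      rw [div_le_iff₀ (by positivity)]
      nlinarith
    have h1 : c • (1 : E) + (x - (m * c) • (1 : E))⁺ ≤ c • (1 : E) + t • (x * x) := by
      refine add_le_add_right ((posPart_sub_smul_le x (by positivity)).trans ?_) _
      exact smul_le_smul_right_of_nonneg hmc (mul_self_nonneg_of_lattice x)
    refine (abs_commutator_le_of_nonneg hx hy hc.le m).trans ((add_le_add
      (mul_le_mul_of_nonneg_right h1 hy) (mul_le_mul_of_nonneg_left h1 hy)).trans_eq ?_)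
    simp only [add_mul, mul_add, smul_mul_assoc, mul_smul_comm, one_mul, mul_one]
    module
  have h2 := le_antisymm ((le_abs_self _).trans h)
    (by simpa using neg_le_neg ((neg_le_abs (x * y - y * x)).trans h))
  exact sub_eq_zero.1 h2

theorem mul_comm_of_isFAlgebra (x y : E) : x * y = y * x := by
  have h := fun {p q : E} => mul_comm_of_nonneg (E := E) (x := p) (y := q)
  rw [← posPart_sub_negPart x, ← posPart_sub_negPart y]
  simp only [sub_mul, mul_sub, h (posPart_nonneg x) (posPart_nonneg y),
    h (posPart_nonneg x) (negPart_nonneg y), h (negPart_nonneg x) (posPart_nonneg y),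
    h (negPart_nonneg x) (negPart_nonneg y)]
  abel

end Commutative

end PhiAlgebra

namespace PhiAlgebra

/-! ### Bands, band projections and weak order units in terms of idempotents. -/

section Idempotents

variable {E : Type u} [CommRing E] [ConditionallyCompleteLattice E] [IsOrderedAddMonoid E]
  [Algebra ℝ E] [PosSMulMono ℝ E] [IsFAlgebra E]

theorem eq_zero_of_mul_self_eq_zero {x : E} (h : x * x = 0) : x = 0 := by
  have key : ∀ y : E, y * y = 0 → y ≤ 0 := fun y hy =>
    nonpos_of_forall_le_smul (y := 1) fun t ht => by
      simpa [hy] using le_smul_one_add_smul_mul_self y ht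
  exact le_antisymm (key x h) (by simpa using key (-x) (by simpa using h))

theorem inf_eq_zero_iff_mul_eq_zero {x y : E} (hx : 0 ≤ x) (hy : 0 ≤ y) :
    x ⊓ y = 0 ↔ x * y = 0 := by
  refine ⟨mul_eq_zero_of_inf_eq_zero, fun h => eq_zero_of_mul_self_eq_zero ?_⟩
  have h0 : 0 ≤ x ⊓ y := le_inf hx hy
  exact le_antisymm (h ▸ mul_le_mul inf_le_left inf_le_right h0 hx) (mul_nonneg h0 h0)

theorem abs_mul_of_nonneg_right (z : E) {w : E} (hw : 0 ≤ w) : |z * w| = |z| * w := by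
  have h1 : z⁺ * z⁻ = 0 := mul_eq_zero_of_inf_eq_zero (posPart_inf_negPart_eq_zero z)
  have hp := mul_nonneg (posPart_nonneg z) hw
  have hn := mul_nonneg (negPart_nonneg z) hw
  have h2 : (z⁺ * w) ⊓ (z⁻ * w) = 0 := by
    rw [inf_eq_zero_iff_mul_eq_zero hp hn]
    linear_combination w * w * h1
  have h3 : z * w = z⁺ * w - z⁻ * w := by rw [← sub_mul, posPart_sub_negPart]
  have h4 : |z| * w = z⁺ * w + z⁻ * w := by rw [← add_mul, posPart_add_negPart]
  rw [h3, h4, ← sup_sub_inf_eq_abs_sub, ← inf_add_sup (z⁺ * w), inf_comm (z⁻ * w),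
    sup_comm (z⁻ * w), h2]
  simp

theorem abs_mul_eq_zero_iff {z w : E} (hw : 0 ≤ w) : |z| * w = 0 ↔ z * w = 0 := by
  rw [← abs_mul_of_nonneg_right z hw]
  refine ⟨fun h => ?_, fun h => by rw [h, abs_zero]⟩
  exact le_antisymm (h ▸ le_abs_self _) (neg_nonpos.1 (h ▸ neg_le_abs (z * w)))

theorem abs_inf_eq_zero_iff {z w : E} (hw : 0 ≤ w) : |z| ⊓ w = 0 ↔ z * w = 0 := by
  rw [inf_eq_zero_iff_mul_eq_zero (abs_nonneg z) hw, abs_mul_eq_zero_iff hw]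

theorem nonneg_of_idempotent {e : E} (he : e * e = e) : 0 ≤ e :=
  he ▸ mul_self_nonneg_of_lattice e

theorem idempotent_one_sub {e : E} (he : e * e = e) : (1 - e) * (1 - e) = 1 - e := by
  linear_combination he

theorem idempotent_le_one {e : E} (he : e * e = e) : e ≤ 1 :=
  sub_nonneg.1 (nonneg_of_idempotent (idempotent_one_sub he))

theorem idempotent_mul_le {e x : E} (he : e * e = e) (hx : 0 ≤ x) : e * x ≤ x :=
  mul_le_of_le_one_left hx (idempotent_le_one he)

/-- Take `e = sup {z ∈ D : z ≤ 1}`. For `x ∈ D`, adding `(1 - e) ⊓ x` to `e` stays in that set, so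
`1 - e` and `x` are disjoint and `(1 - e) * x = 0`. -/
theorem exists_idempotent_of_solid {D : Set E} (h0 : 0 ∈ D) (hpos : ∀ x ∈ D, 0 ≤ x)
    (hadd : ∀ x ∈ D, ∀ y ∈ D, x + y ∈ D) (hle : ∀ x ∈ D, ∀ y, 0 ≤ y → y ≤ x → y ∈ D)
    (hsup : ∀ S ⊆ D, S.Nonempty → ∀ s, IsLUB S s → s ∈ D) :
    ∃ e ∈ D, e * e = e ∧ ∀ x ∈ D, e * x = x := by
  set S := {z | z ∈ D ∧ z ≤ 1}
  have hS : IsLUB S (sSup S) := isLUB_csSup ⟨0, h0, zero_le_one⟩ ⟨1, fun z hz => hz.2⟩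
  set e := sSup S
  have he1 : e ≤ 1 := hS.2 fun z hz => hz.2
  have heD : e ∈ D := hsup S (fun z hz => hz.1) ⟨0, h0, zero_le_one⟩ e hS
  have key : ∀ x ∈ D, e * x = x := by
    intro x hx
    have ht0 : 0 ≤ (1 - e) ⊓ x := le_inf (sub_nonneg.2 he1) (hpos x hx)
    have ht : (1 - e) ⊓ x ∈ D := hle x hx _ ht0 inf_le_right
    have h1 : e + (1 - e) ⊓ x ≤ e :=
      hS.1 ⟨hadd _ heD _ ht, (add_le_add_right inf_le_left e).trans (by simp)⟩
    have h2 := mul_eq_zero_of_inf_eq_zero (le_antisymm (by simpa using h1) ht0)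
    linear_combination -h2
  exact ⟨e, heD, key e heD, key⟩

/-- The support of `w`: the complement of the idempotent that generates the disjoint complement of
`w`. -/
theorem exists_support_idempotent {w : E} (hw : 0 ≤ w) :
    ∃ e : E, e * e = e ∧ e * w = w ∧ ∀ z, z * w = 0 → z * e = 0 := by
  obtain ⟨e, heD, he, hD⟩ := exists_idempotent_of_solid (D := {z : E | z ⊓ w = 0})
    (by simpa using hw) (fun x hx => (show x ⊓ w = 0 from hx) ▸ inf_le_left)
    (fun x hx y hy => add_inf_eq_zero hx hy)
    (fun x hx y hy hyx => le_antisymm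
      ((inf_le_inf_right w hyx).trans (show x ⊓ w = 0 from hx).le) (le_inf hy hw))
    (fun S hS hne s hs => by
      have h1 : s ≤ s ⊔ w - w := hs.2 fun z hz => by
        have hz0 : z ⊓ w = 0 := hS hz
        rw [le_sub_iff_add_le, ← inf_add_sup z w, hz0, zero_add]
        exact sup_le_sup_right (hs.1 hz) w
      obtain ⟨z, hz⟩ := hne
      have hz0 : z ⊓ w = 0 := hS hz
      have hs0 : 0 ≤ s := (hz0 ▸ inf_le_left : 0 ≤ z).trans (hs.1 hz)
      refine le_antisymm ?_ (le_inf hs0 hw)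
      have h2 := inf_add_sup s w
      rw [le_sub_iff_add_le, ← h2] at h1
      simpa using h1)
  have hew : e * w = 0 := mul_eq_zero_of_inf_eq_zero heD
  refine ⟨1 - e, idempotent_one_sub he, by linear_combination -hew, fun z hz => ?_⟩
  have h1 := hD |z| ((abs_inf_eq_zero_iff hw).2 hz)
  rw [← abs_mul_eq_zero_iff (nonneg_of_idempotent (idempotent_one_sub he))]
  linear_combination -h1

/-- The band `e E` of an idempotent `e`. -/
def idempotentBand (e : E) : Submodule ℝ E where
  carrier := {x | e * x = x}
  add_mem' {x y} hx hy := by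
    change e * (x + y) = x + y
    rw [mul_add, show e * x = x from hx, show e * y = y from hy]
  zero_mem' := mul_zero e
  smul_mem' c x hx := by
    change e * (c • x) = c • x
    rw [mul_smul_comm, show e * x = x from hx]

theorem mem_idempotentBand {e x : E} : x ∈ idempotentBand e ↔ e * x = x := Iff.rfl

theorem isBand_idempotentBand {e : E} (he : e * e = e) : IsBand (idempotentBand e) := by
  have he0 := nonneg_of_idempotent he
  have he1 := nonneg_of_idempotent (idempotent_one_sub he)
  refine ⟨fun x hx y hyx => ?_, fun S hS s hs => ?_⟩
  · rw [mem_idempotentBand] at hx ⊢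
    have h1 : |x| * (1 - e) = 0 := by
      rw [abs_mul_eq_zero_iff he1]; linear_combination -hx
    have h2 : |y| * (1 - e) = 0 := le_antisymm
      ((mul_le_mul_of_nonneg_right hyx he1).trans_eq h1) (mul_nonneg (abs_nonneg y) he1)
    rw [abs_mul_eq_zero_iff he1] at h2
    linear_combination -h2
  · have hx : ∀ x ∈ S, e * x = x := fun x hx => hS hx
    have h1 : s ≤ e * s := hs.2 fun x hxS => by
      rw [← hx x hxS]; exact mul_le_mul_of_nonneg_left (hs.1 hxS) he0
    -- A supremum of the empty set is a least element of `E`; this degenerate case needs its own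
    -- argument.
    rcases S.eq_empty_or_nonempty with rfl | ⟨x, hxS⟩
    · rw [isLUB_empty_iff] at hs
      exact le_antisymm (by simpa using hs (s + (s - e * s))) h1
    · have h2 := mul_le_mul_of_nonneg_left (hs.1 hxS) he1
      have h3 : (1 - e) * x = 0 := by linear_combination -hx x hxS
      rw [h3, sub_mul, one_mul, sub_nonneg] at h2
      exact le_antisymm h2 h1

theorem IsBand.exists_idempotent {B : Submodule ℝ E} (hB : IsBand B) :
    ∃ e : E, e * e = e ∧ B = idempotentBand e := by
  have hle : ∀ x ∈ B, ∀ y, 0 ≤ y → y ≤ x → y ∈ B := fun x hx y hy hyx =>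
    hB.1 x hx y (by rwa [abs_of_nonneg hy, abs_of_nonneg (hy.trans hyx)])
  obtain ⟨e, heD, he, hD⟩ := exists_idempotent_of_solid (D := {z : E | z ∈ B ∧ 0 ≤ z})
    ⟨B.zero_mem, le_rfl⟩ (fun x hx => hx.2)
    (fun x hx y hy => ⟨B.add_mem hx.1 hy.1, add_nonneg hx.2 hy.2⟩)
    (fun x hx y hy hyx => ⟨hle x hx.1 y hy hyx, hy⟩)
    (fun S hS hne s hs => ⟨hB.2 S (fun z hz => (hS hz).1) s hs,
      hne.elim fun z hz => (hS hz).2.trans (hs.1 hz)⟩)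
  have he0 := nonneg_of_idempotent he
  have he1 := nonneg_of_idempotent (idempotent_one_sub he)
  refine ⟨e, he, Submodule.ext fun x => ?_⟩
  rw [mem_idempotentBand]
  constructor
  · intro hx
    have h1 := hD |x| ⟨hB.1 x hx _ (abs_abs x).le, abs_nonneg x⟩
    have h2 : x * (1 - e) = 0 := by
      rw [← abs_mul_eq_zero_iff he1]; linear_combination -h1
    linear_combination -h2
  · intro hx
    have hy : e * |x| = |x| := by
      rw [mul_comm, ← abs_mul_of_nonneg_right x he0, mul_comm, hx]
    -- The part `s` of `|x|` in `B` is all of `|x|`: by maximality `|x| - s` is disjoint from `e`,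
    -- while `e` fixes both `|x|` and `s`.
    set S := {z : E | z ∈ B ∧ 0 ≤ z ∧ z ≤ |x|}
    have h0S : (0 : E) ∈ S := ⟨B.zero_mem, le_rfl, abs_nonneg x⟩
    have hS : IsLUB S (sSup S) := isLUB_csSup ⟨0, h0S⟩ ⟨|x|, fun z hz => hz.2.2⟩
    set s := sSup S
    have hsB : s ∈ B := hB.2 S (fun z hz => hz.1) s hS
    have hs0 : 0 ≤ s := hS.1 h0S
    have hsx : s ≤ |x| := hS.2 fun z hz => hz.2.2
    have ht0 : 0 ≤ (|x| - s) ⊓ e := le_inf (sub_nonneg.2 hsx) he0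
    have h1 : s + (|x| - s) ⊓ e ≤ s :=
      hS.1 ⟨B.add_mem hsB (hle e heD.1 _ ht0 inf_le_right), add_nonneg hs0 ht0,
        (add_le_add_right inf_le_left s).trans (by simp)⟩
    have h2 := mul_eq_zero_of_inf_eq_zero (le_antisymm (by simpa using h1) ht0)
    have h3 := hD s ⟨hsB, hs0⟩
    have h4 : |x| = s := by linear_combination h2 - hy + h3
    exact hB.1 s hsB x (by rw [abs_of_nonneg hs0, h4])

theorem bandProj_idempotentBand {e : E} (he : e * e = e) (x : E) :
    bandProj (idempotentBand e) x = e * x := by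
  have he0 := nonneg_of_idempotent he
  have key : ∀ y : E, 0 ≤ y → sSup {z : E | z ∈ idempotentBand e ∧ 0 ≤ z ∧ z ≤ y} = e * y := by
    intro y hy
    refine IsGreatest.csSup_eq ⟨⟨?_, mul_nonneg he0 hy, idempotent_mul_le he hy⟩, ?_⟩
    · rw [mem_idempotentBand, ← mul_assoc, he]
    · rintro z ⟨hz, -, hzy⟩
      rw [← mem_idempotentBand.1 hz]
      exact mul_le_mul_of_nonneg_left hzy he0
  rw [bandProj, key _ le_sup_right, key _ le_sup_right, ← mul_sub]
  exact congrArg _ (posPart_sub_negPart x)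

theorem LocallyBandPreservingOn.mul_eq_mul {f : E → E} {D : Set E}
    (hf : LocallyBandPreservingOn f D) {e : E} (he : e * e = e) {x y : E} (hx : x ∈ D)
    (hy : y ∈ D) (h : e * x = e * y) : e * f x = e * f y := by
  have := hf _ (isBand_idempotentBand he) x hx y hy
  simp only [bandProj_idempotentBand he] at this
  exact this h

theorem isWeakOrderUnitOf_iff {B : Submodule ℝ E} {w : E} :
    IsWeakOrderUnitOf B w ↔ w ∈ B ∧ 0 ≤ w ∧ ∀ z ∈ B, z * w = 0 → z = 0 := by
  refine and_congr_right fun _ => and_congr_right fun hw => forall₂_congr fun z _ => ?_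
  rw [abs_inf_eq_zero_iff hw]

theorem wayLT_iff {x y : E} : WayLT x y ↔ x ≤ y ∧ ∀ z, z * (y - x) = 0 → z = 0 := by
  rw [WayLT, isWeakOrderUnitOf_iff]
  simp

theorem wayLT_of_le_sub {x y x' y' : E} (h : WayLT x y) (hle : y - x ≤ y' - x') :
    WayLT x' y' := by
  have h0 := sub_nonneg.2 (wayLT_iff.1 h).1
  refine ⟨Submodule.mem_top, h0.trans hle, fun z hz hz0 => h.2.2 z hz ?_⟩
  exact le_antisymm ((inf_le_inf_left _ hle).trans_eq hz0) (le_inf (abs_nonneg z) h0)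

theorem WayLT.of_smul_sub {x y x' y' : E} (h : WayLT x y) {t : ℝ} (ht : 0 < t)
    (hle : t • (y - x) ≤ y' - x') : WayLT x' y' := by
  refine wayLT_of_le_sub (x := 0) (y := t • (y - x)) (wayLT_iff.2 ⟨?_, fun z hz => ?_⟩) (by simpa)
  · exact smul_nonneg ht.le (sub_nonneg.2 (wayLT_iff.1 h).1)
  · rw [sub_zero, mul_smul_comm, smul_eq_zero_iff_right ht.ne'] at hz
    exact (wayLT_iff.1 h).2 z hz

/-- With `d = y - x`, a competing band `g E` has `g d ≥ 0`, so `g d * g d⁻ = -(g d⁻)²` forces `g d⁻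
= 0`. Hence `g d` lives on the support `e` of `d⁺`. -/
theorem bandLT_eq_idempotentBand {x y e : E} (he : e * e = e) (hew : e * (y - x)⁺ = (y - x)⁺)
    (hez : ∀ z, z * (y - x)⁺ = 0 → z * e = 0) : bandLT x y = idempotentBand e := by
  set d := y - x
  have hdd : d⁺ * d⁻ = 0 := mul_eq_zero_of_inf_eq_zero (posPart_inf_negPart_eq_zero d)
  have hd : d = d⁺ - d⁻ := (posPart_sub_negPart d).symm
  refine le_antisymm (sSup_le ?_) (le_sSup ⟨isBand_idempotentBand he, ?_⟩)
  · rintro B ⟨hB, hBw⟩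
    obtain ⟨g, hg, rfl⟩ := hB.exists_idempotent
    rw [bandProj_idempotentBand hg, isWeakOrderUnitOf_iff] at hBw
    obtain ⟨-, hw0, hw⟩ := hBw
    have hgd : g * d⁻ = 0 := by
      have h0 : 0 ≤ g * d⁻ := mul_nonneg (nonneg_of_idempotent hg) (negPart_nonneg d)
      refine eq_zero_of_mul_self_eq_zero (le_antisymm ?_ (mul_nonneg h0 h0))
      have h1 := mul_nonneg hw0 h0
      rw [← neg_nonneg]
      refine h1.trans_eq ?_
      linear_combination g * g * d⁻ * hd + g * g * hdd
    intro z hz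
    rw [mem_idempotentBand] at hz ⊢
    have h2 := hw ((1 - e) * z) (by rw [mem_idempotentBand]; linear_combination (1 - e) * hz) (by
      linear_combination (1 - e) * z * g * hd - z * g * hew - (1 - e) * z * hgd)
    linear_combination -h2
  · rw [bandProj_idempotentBand he]
    have h1 : e * d = d⁺ := by
      linear_combination e * hd + hew - hez d⁻ (by rw [mul_comm]; exact hdd)
    rw [h1, isWeakOrderUnitOf_iff]
    refine ⟨hew, posPart_nonneg d, fun z hz hz0 => ?_⟩
    rw [← mem_idempotentBand.1 hz, mul_comm]
    exact hez z hz0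

/-- Multiplication by an unbounded `k` still respects `s - x ↓ 0`: bound `k` by `T + t k²`, with `T
= 1 / (4t)`, freeze the second term at `x₀`, take the supremum over `x`, then let `t → 0`. -/
theorem nonpos_of_forall_le_mul_sub {S : Set E} (hS : DirectedOn (· ≤ ·) S) {s : E}
    (hs : IsLUB S s) {x₀ : E} (hx₀ : x₀ ∈ S) {k w : E}
    (h : ∀ x ∈ S, x₀ ≤ x → w ≤ k * (s - x)) : w ≤ 0 := by
  refine nonpos_of_forall_le_smul (y := k * k * (s - x₀)) fun t ht => ?_
  set T := 1 / (4 * t) with hT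
  have hT0 : 0 < T := by positivity
  have hTt : 1 / (4 * T) = t := by rw [hT]; field_simp
  have key : s ≤ s + (1 / T) • (t • (k * k * (s - x₀)) - w) := by
    refine hs.2 fun y hy => ?_
    obtain ⟨x, hx, hyx, hx₀x⟩ := hS y hy x₀ hx₀
    refine hyx.trans ?_
    have hsx : 0 ≤ s - x := sub_nonneg.2 (hs.1 hx)
    have h1 : w ≤ T • (s - x) + t • (k * k * (s - x₀)) := by
      refine (h x hx hx₀x).trans ((mul_le_mul_of_nonneg_right
        (le_smul_one_add_smul_mul_self k hT0) hsx).trans ?_)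
      rw [hTt, add_mul, smul_mul_assoc, one_mul, smul_mul_assoc]
      exact add_le_add_right (smul_le_smul_of_nonneg_left (mul_le_mul_of_nonneg_left
        (sub_le_sub_left hx₀x s) (mul_self_nonneg_of_lattice k)) ht.le) _
    have h2 := smul_nonneg (a := 1 / T) (by positivity) (sub_nonneg.2 h1)
    rw [← sub_nonneg]
    refine h2.trans_eq ?_
    match_scalars <;> field_simp
  have h3 := smul_nonneg hT0.le (sub_nonneg.2 key)
  rw [add_sub_cancel_left, smul_smul, mul_one_div_cancel hT0.ne', one_smul] at h3
  exact sub_nonneg.1 h3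

end Idempotents

end PhiAlgebra

namespace PhiAlgebra

/-! ### The mean value inequality. -/

section MeanValue

variable {E : Type u} [CommRing E] [ConditionallyCompleteLattice E] [IsOrderedAddMonoid E]
  [Algebra ℝ E] [PosSMulMono ℝ E] [IsFAlgebra E]

/-- `F` is a locally band preserving, order continuous order antiderivative on `[a, b]` of the
order bounded, locally band preserving function `f`. -/
structure IsOrderPrimitive (a b : E) (f F : E → E) : Prop where
  wayLT : WayLT a b
  bdd : OrderBoundedOn f (Set.Icc a b)
  lbp : LocallyBandPreservingOn f (Set.Icc a b)
  cont : OrderContinuousOn F (Set.Icc a b)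
  deriv : ∀ c ∈ openInterval a b, HasOrderDerivAt F (Set.Icc a b) c (f c)
  lbp' : LocallyBandPreservingOn F (Set.Icc a b)

theorem LocallyBandPreservingOn.neg {f : E → E} {D : Set E} (hf : LocallyBandPreservingOn f D) :
    LocallyBandPreservingOn (-f) D := by
  intro B hB x hx y hy hxy
  obtain ⟨e, he, rfl⟩ := hB.exists_idempotent
  have := hf _ hB x hx y hy hxy
  simp only [bandProj_idempotentBand he, Pi.neg_apply, mul_neg] at this ⊢
  rw [this]

theorem OrderBoundedOn.neg {f : E → E} {D : Set E} (hf : OrderBoundedOn f D) :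
    OrderBoundedOn (-f) D :=
  let ⟨m, M, h⟩ := hf
  ⟨-M, -m, fun x hx => ⟨neg_le_neg (h x hx).2, neg_le_neg (h x hx).1⟩⟩

theorem IsOrderPrimitive.neg {a b : E} {f F : E → E} (h : IsOrderPrimitive a b f F) :
    IsOrderPrimitive a b (-f) (-F) where
  wayLT := h.wayLT
  bdd := h.bdd.neg
  lbp := h.lbp.neg
  lbp' := h.lbp'.neg
  cont c hc ι _ _ _ x hx hxc := by
    obtain ⟨Eps, hE, hEps⟩ := h.cont c hc ι x hx hxc
    refine ⟨Eps, hE, fun ε hε => (hEps ε hε).imp fun α₀ hα₀ α hα => ?_⟩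
    have := hα₀ α hα
    rwa [abs_sub_comm, ← neg_sub_neg] at this
  deriv c hc := by
    obtain ⟨r, hr, hrD, H⟩ := h.deriv c hc
    refine ⟨r, hr, hrD, fun Δ h1 h2 h3 => ?_⟩
    obtain ⟨Eps, hE, hEps⟩ := H Δ h1 h2 h3
    refine ⟨Eps, hE, fun ε hε => ?_⟩
    obtain ⟨δ, hδ, hx⟩ := hEps ε hε
    refine ⟨δ, hδ, fun x hxr hxδ => ?_⟩
    rw [← abs_neg]
    convert hx x hxr hxδ using 2
    simp only [Pi.neg_apply]
    ring

theorem mul_add_one_sub_mul_mem_Icc {e u v x y : E} (he : e * e = e) (hx : x ∈ Set.Icc u v)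
    (hy : y ∈ Set.Icc u v) : e * x + (1 - e) * y ∈ Set.Icc u v := by
  have he0 := nonneg_of_idempotent he
  have he1 := nonneg_of_idempotent (idempotent_one_sub he)
  constructor <;> rw [← sub_nonneg]
  · refine (add_nonneg (mul_nonneg he0 (sub_nonneg.2 hx.1))
      (mul_nonneg he1 (sub_nonneg.2 hy.1))).trans_eq ?_
    ring
  · refine (add_nonneg (mul_nonneg he0 (sub_nonneg.2 hx.2))
      (mul_nonneg he1 (sub_nonneg.2 hy.2))).trans_eq ?_
    ring

theorem sup_eq_add_posPart_sub (x y : E) : x ⊔ y = x + (y - x)⁺ := by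
  rw [posPart_def, add_sup]
  simp [sup_comm]

theorem support_mul_sup {x y e : E} (hew : e * (y - x)⁺ = (y - x)⁺)
    (hez : ∀ z, z * (y - x)⁺ = 0 → z * e = 0) :
    e * (x ⊔ y) = e * y ∧ (1 - e) * (x ⊔ y) = (1 - e) * x := by
  have h1 := hez _ (mul_eq_zero_of_inf_eq_zero (x := (y - x)⁻) (y := (y - x)⁺)
    (by rw [inf_comm]; exact posPart_inf_negPart_eq_zero _))
  have h2 := posPart_sub_negPart (y - x)
  rw [sup_eq_add_posPart_sub]
  constructor
  · linear_combination h1 + e * h2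
  · linear_combination -hew

theorem isGLB_range_smul_one : IsGLB {δ : E | ∃ t : ℝ, 0 < t ∧ δ = t • (1 : E)} 0 := by
  refine ⟨?_, fun y hy => nonpos_of_forall_le_smul (y := 1) fun t ht => hy ⟨t, ht, rfl⟩⟩
  rintro _ ⟨t, ht, rfl⟩
  exact smul_nonneg ht.le zero_le_one

theorem directedOn_range_smul_one :
    DirectedOn (· ≥ ·) {δ : E | ∃ t : ℝ, 0 < t ∧ δ = t • (1 : E)} := by
  rintro _ ⟨s, hs, rfl⟩ _ ⟨t, ht, rfl⟩
  exact ⟨_, ⟨min s t, lt_min hs ht, rfl⟩,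
    smul_le_smul_right_of_nonneg (min_le_left _ _) zero_le_one,
    smul_le_smul_right_of_nonneg (min_le_right _ _) zero_le_one⟩

/-- The directed set `S`, indexed by itself, is a net converging to `s`. -/
theorem OrderContinuousOn.sub_le_mul_of_isLUB {a b : E} {F : E → E}
    (hF : OrderContinuousOn F (Set.Icc a b)) {S : Set E} (hSD : S ⊆ Set.Icc a b)
    (hne : S.Nonempty) (hS : DirectedOn (· ≤ ·) S) {s : E} (hs : IsLUB S s) {u C K : E}
    (h : ∀ x ∈ S, F x - C ≤ K * (x - u)) : F s - C ≤ K * (s - u) := by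
  obtain ⟨x₁, hx₁⟩ := hne
  have hsD : s ∈ Set.Icc a b :=
    ⟨(hSD hx₁).1.trans (hs.1 hx₁), hs.2 fun x hx => (hSD hx).2⟩
  have : Nonempty S := ⟨⟨x₁, hx₁⟩⟩
  have : IsDirectedOrder S := directedOn_iff_isDirectedOrder.1 hS
  obtain ⟨Eps, hE, hEps⟩ := hF s hsD S (fun x => x.1) (fun x => hSD x.2)
    ⟨{d | ∃ x ∈ S, d = s - x}, ⟨by
      rintro _ ⟨x, hx, rfl⟩
      exact sub_nonneg.2 (hs.1 hx), fun y hy => by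
      have : s ≤ s - y := hs.2 fun x hx => le_sub_comm.1 (hy ⟨x, hx, rfl⟩)
      simpa using this⟩, by
      rintro _ ⟨x, hx, rfl⟩
      refine ⟨⟨x, hx⟩, fun α hα => ?_⟩
      rw [abs_sub_comm, abs_of_nonneg (sub_nonneg.2 (hs.1 α.2))]
      exact sub_le_sub_left (show x ≤ α.1 from hα) s⟩
  rw [← sub_nonpos]
  refine hE.2 fun ε hε => ?_
  obtain ⟨x₀, hx₀⟩ := hEps ε hε
  rw [← sub_nonpos]
  refine nonpos_of_forall_le_mul_sub hS hs x₀.2 (k := -K) fun x hx hxx => ?_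
  have h1 := (neg_le_abs _).trans (hx₀ ⟨x, hx⟩ hxx)
  have h2 := add_nonneg (sub_nonneg.2 h1) (sub_nonneg.2 (h x hx))
  rw [← sub_nonneg]
  refine h2.trans_eq ?_
  ring

namespace IsOrderPrimitive

variable {a b : E} {f F : E → E}

theorem sub_le_mul_of_wayLT (h : IsOrderPrimitive a b f F) {u v M : E} (hau : WayLT a u)
    (huv : u ≤ v) (hvb : WayLT v b) (hM : ∀ z ∈ Set.Icc u v, f z ≤ M) :
    F v - F u ≤ M * (v - u) := by
  refine le_of_forall_le_add_smul (z := v - u) fun η hη => ?_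
  set K := M + η • (1 : E) with hK
  have hIcc : Set.Icc u v ⊆ Set.Icc a b :=
    Set.Icc_subset_Icc (wayLT_iff.1 hau).1 (wayLT_iff.1 hvb).1
  set S := {x | x ∈ Set.Icc u v ∧ F x - F u ≤ K * (x - u)}
  have huS : u ∈ S := ⟨⟨le_rfl, huv⟩, by simp⟩
  -- `x ⊔ y` equals `y` on the support of `(y - x)⁺` and `x` off it, so `F (x ⊔ y)` is glued from `F
  -- y` and `F x` in the same way.
  have hS : DirectedOn (· ≤ ·) S := by
    intro x hx y hy
    refine ⟨x ⊔ y, ⟨⟨hx.1.1.trans le_sup_left, sup_le hx.1.2 hy.1.2⟩, ?_⟩,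
      le_sup_left, le_sup_right⟩
    obtain ⟨e, he, hew, hez⟩ := exists_support_idempotent (posPart_nonneg (y - x))
    obtain ⟨h1, h2⟩ := support_mul_sup hew hez
    have hmem : x ⊔ y ∈ Set.Icc a b :=
      hIcc ⟨hx.1.1.trans le_sup_left, sup_le hx.1.2 hy.1.2⟩
    have H1 := h.lbp'.mul_eq_mul he hmem (hIcc hy.1) h1
    have H2 := h.lbp'.mul_eq_mul (idempotent_one_sub he) hmem (hIcc hx.1) h2
    have H3 := add_nonneg (mul_nonneg (nonneg_of_idempotent he) (sub_nonneg.2 hy.2))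
      (mul_nonneg (nonneg_of_idempotent (idempotent_one_sub he)) (sub_nonneg.2 hx.2))
    rw [← sub_nonneg]
    refine H3.trans_eq ?_
    linear_combination H1 + H2 - K * h1 - K * h2
  have hs : IsLUB S (sSup S) := isLUB_csSup ⟨u, huS⟩ ⟨v, fun x hx => hx.1.2⟩
  set s := sSup S
  have hsI : s ∈ Set.Icc u v := ⟨hs.1 huS, hs.2 fun x hx => hx.1.2⟩
  have hsS : F s - F u ≤ K * (s - u) :=
    h.cont.sub_le_mul_of_isLUB (fun x hx => hIcc hx.1) ⟨u, huS⟩ hS hs fun x hx => hx.2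
  have hso : s ∈ openInterval a b :=
    ⟨wayLT_of_le_sub hau (sub_le_sub_right hsI.1 a), wayLT_of_le_sub hvb (sub_le_sub_left hsI.2 b)⟩
  obtain ⟨r, hr, -, hderiv⟩ := h.deriv s hso
  obtain ⟨Eps, hE, hEps⟩ := hderiv {δ | ∃ t : ℝ, 0 < t ∧ δ = t • (1 : E)}
    ⟨_, 1, one_pos, rfl⟩
    directedOn_range_smul_one isGLB_range_smul_one
  have hw0 : 0 ≤ v - s := sub_nonneg.2 hsI.2
  have hr0 : 0 ≤ r := (wayLT_iff.1 hr).1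
  -- On the band where `ε < η` the derivative estimate lets `s` advance, so maximality forces `s =
  -- v` there.
  have key : ∀ ε ∈ Eps, (v - s) * (η • (1 : E) - ε)⁺ = 0 := by
    intro ε hε
    obtain ⟨_, ⟨t, ht, rfl⟩, hδ⟩ := hEps ε hε
    set p := η • (1 : E) - ε with hp
    obtain ⟨e, he, hew, hez⟩ := exists_support_idempotent (posPart_nonneg p)
    have he0 := nonneg_of_idempotent he
    -- The three bounds keep `s + e * k` below `v`, within `δ = t • 1` of `s`, and inside `(s - r, s
    -- + r)`; the half leaves a weak order unit to spare.
    set k := (v - s) ⊓ t • (1 : E) ⊓ (1 / 2 : ℝ) • r with hk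
    have ht1 : 0 ≤ t • (1 : E) := smul_nonneg ht.le zero_le_one
    have hr2 : 0 ≤ (1 / 2 : ℝ) • r := smul_nonneg (by positivity) hr0
    have hk0 : 0 ≤ k := le_inf (le_inf hw0 ht1) hr2
    have hek0 : 0 ≤ e * k := mul_nonneg he0 hk0
    have hek : e * k ≤ k := idempotent_mul_le he hk0
    have hekr : e * k ≤ (1 / 2 : ℝ) • r := hek.trans inf_le_right
    have hrr : r - (1 / 2 : ℝ) • r = (1 / 2 : ℝ) • r := by module
    have hrr' : (1 / 2 : ℝ) • r ≤ r - e * k := by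
      rw [← hrr]; exact sub_le_sub_left hekr r
    have hxo : s + e * k ∈ openInterval (s - r) (s + r) := by
      refine ⟨hr.of_smul_sub (t := 1 / 2) (by norm_num) ?_,
        hr.of_smul_sub (t := 1 / 2) (by norm_num) ?_⟩
      · rw [sub_zero]
        exact (hrr'.trans (sub_le_self r hek0)).trans
          ((le_add_of_nonneg_right hek0).trans_eq (by ring))
      · rw [sub_zero]
        exact hrr'.trans_eq (by ring)
    have habs : |s + e * k - s| = e * k := by rw [add_sub_cancel_left, abs_of_nonneg hek0]
    have hd := hδ _ hxo (habs.trans_le (hek.trans (inf_le_left.trans inf_le_right)))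
    rw [habs] at hd
    have hd' := (le_abs_self _).trans hd
    have hxS : s + e * k ∈ S := by
      refine ⟨⟨hsI.1.trans (le_add_of_nonneg_right hek0), ?_⟩, ?_⟩
      · rw [← le_sub_iff_add_le']
        exact hek.trans (inf_le_left.trans inf_le_left)
      · have h1 := mul_nonneg hek0 (sub_nonneg.2 (hM s hsI))
        have h2 : 0 ≤ e * k * p := by
          have hep : e * p = p⁺ := by
            have h3 := hez p⁻ (mul_eq_zero_of_inf_eq_zero
              (by rw [inf_comm]; exact posPart_inf_negPart_eq_zero p))
            linear_combination hew - h3 - e * posPart_sub_negPart p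
          rw [mul_right_comm, hep]
          exact mul_nonneg (posPart_nonneg p) hk0
        have h3 := add_nonneg (add_nonneg h1 h2)
          (add_nonneg (sub_nonneg.2 hsS) (sub_nonneg.2 hd'))
        rw [← sub_nonneg]
        refine h3.trans_eq ?_
        rw [hK, hp]
        ring
    have hek1 : e * k = 0 := le_antisymm (by simpa using hs.1 hxS) hek0
    have hwe : (v - s) * e = 0 := by
      rw [← inf_eq_zero_iff_mul_eq_zero hw0 he0]
      have hq0 : 0 ≤ (v - s) ⊓ e := le_inf hw0 he0
      have h1 : k * e = 0 := by rw [mul_comm]; exact hek1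
      rw [← inf_eq_zero_iff_mul_eq_zero hk0 he0] at h1
      have h2 : ((v - s) ⊓ e ⊓ t • (1 : E)) * ((1 / 2 : ℝ) • r) = 0 := by
        refine mul_eq_zero_of_inf_eq_zero (Eq.trans ?_ h1)
        rw [hk]; ac_rfl
      rw [mul_smul_comm, smul_eq_zero_iff_right (by norm_num)] at h2
      have h3 := (wayLT_iff.1 hr).2 _ (by rw [sub_zero]; exact h2)
      have h4 := mul_eq_zero_of_inf_eq_zero h3
      rwa [mul_smul_comm, smul_eq_zero_iff_right ht.ne', mul_one] at h4
    linear_combination p⁺ * hwe - (v - s) * hew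
  -- On the support `g` of `v - s` every `ε` is at least `η`, so `inf Eps = 0` forces `g = 0`.
  have hsv : v = s := by
    obtain ⟨g, hg, hgw, hgz⟩ := exists_support_idempotent hw0
    have hg0 := nonneg_of_idempotent hg
    have h1 : η • g ≤ 0 := hE.2 fun ε hε => by
      have h2 := hgz _ (by rw [mul_comm]; exact key ε hε)
      have h3 : 0 ≤ (η • (1 : E) - ε)⁻ * g := mul_nonneg (negPart_nonneg _) hg0
      have h4 : η • g ≤ ε * g := by
        rw [← sub_nonneg]
        refine h3.trans_eq ?_
        have h5 := posPart_sub_negPart (η • (1 : E) - ε)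
        have h6 : η • g = η • (1 : E) * g := by rw [smul_mul_assoc, one_mul]
        linear_combination h2 - g * h5 + h6
      exact h4.trans (by rw [mul_comm]; exact idempotent_mul_le hg (hE.1 hε))
    have h2 : η • g = 0 := le_antisymm h1 (smul_nonneg hη.le hg0)
    rw [smul_eq_zero_iff_right hη.ne'] at h2
    rw [← sub_eq_zero, ← hgw, h2, zero_mul]
  rw [hsv]
  refine hsS.trans_eq ?_
  rw [hK, add_mul, smul_mul_assoc, one_mul]

/-- Moving both ends inward by `c n • w` puts them in `(a, b)`; continuity of `F` at `u` and `v`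
recovers the limit. -/
theorem sub_le_mul_of_wayLT_sub (h : IsOrderPrimitive a b f F) {u v M : E} (hau : a ≤ u)
    (huv : WayLT u v) (hvb : v ≤ b) (hM : ∀ z ∈ Set.Icc u v, f z ≤ M) :
    F v - F u ≤ M * (v - u) := by
  have hw0 : 0 ≤ v - u := sub_nonneg.2 (wayLT_iff.1 huv).1
  set w := v - u with hw
  -- The shift `+ 2` gives `c n ≤ 1 / 2`, so the ends do not cross; `ULift` puts the index type in
  -- the universe that `OrderContinuousOn` requires.
  set c : ULift.{u} ℕ → ℝ := fun n => 1 / ((n.down : ℝ) + 2) with hc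
  have hc0 : ∀ n, 0 < c n := fun n => by simp only [hc]; positivity
  have hc2 : ∀ n, c n ≤ 1 / 2 := fun n => by
    simp only [hc]
    gcongr
    linarith [n.down.cast_nonneg (α := ℝ)]
  have hcanti : ∀ m n, m ≤ n → c n ≤ c m := fun m n hmn => by
    simp only [hc]
    gcongr
    exact hmn
  have hclt : ∀ t : ℝ, 0 < t → ∃ n, c n < t := fun t ht => by
    obtain ⟨n, hn⟩ := exists_nat_one_div_lt ht
    refine ⟨⟨n⟩, lt_of_le_of_lt ?_ hn⟩
    simp only [hc]
    gcongr
    norm_num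
  have hcw : ∀ n, 0 ≤ c n • w := fun n => smul_nonneg (hc0 n).le hw0
  have hcw1 : ∀ n, c n • w ≤ w := fun n => by
    simpa using smul_le_smul_right_of_nonneg ((hc2 n).trans (by norm_num : (1 / 2 : ℝ) ≤ 1)) hw0
  have hglb : IsGLB (Set.range fun n => c n • w) 0 := by
    refine ⟨by rintro _ ⟨n, rfl⟩; exact hcw n, fun y hy => ?_⟩
    refine nonpos_of_forall_le_smul (y := w) fun t ht => ?_
    obtain ⟨n, hn⟩ := hclt t ht
    exact (hy ⟨n, rfl⟩).trans (smul_le_smul_right_of_nonneg hn.le hw0)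
  have hu : ∀ n, u + c n • w ∈ Set.Icc u v := fun n =>
    ⟨le_add_of_nonneg_right (hcw n), by rw [← le_sub_iff_add_le']; exact hcw1 n⟩
  have hv : ∀ n, v - c n • w ∈ Set.Icc u v := fun n =>
    ⟨by rw [le_sub_comm]; exact hcw1 n, sub_le_self v (hcw n)⟩
  have huI : Set.Icc u v ⊆ Set.Icc a b := Set.Icc_subset_Icc hau hvb
  have huv' := (wayLT_iff.1 huv).1
  obtain ⟨Eu, hEu, hu'⟩ := h.cont u (huI ⟨le_rfl, huv'⟩) (ULift.{u} ℕ) (fun n => u + c n • w)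
    (fun n => huI (hu n)) ⟨_, hglb, by
      rintro _ ⟨n, rfl⟩
      refine ⟨n, fun m hm => ?_⟩
      rw [add_sub_cancel_left, abs_of_nonneg (hcw m)]
      exact smul_le_smul_right_of_nonneg (hcanti n m hm) hw0⟩
  obtain ⟨Ev, hEv, hv'⟩ := h.cont v (huI ⟨huv', le_rfl⟩) (ULift.{u} ℕ) (fun n => v - c n • w)
    (fun n => huI (hv n)) ⟨_, hglb, by
      rintro _ ⟨n, rfl⟩
      refine ⟨n, fun m hm => ?_⟩
      rw [abs_sub_comm, sub_sub_cancel, abs_of_nonneg (hcw m)]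
      exact smul_le_smul_right_of_nonneg (hcanti n m hm) hw0⟩
  rw [← sub_nonpos]
  refine hEu.2 fun ε₁ hε₁ => ?_
  rw [← sub_nonpos]
  refine hEv.2 fun ε₂ hε₂ => ?_
  obtain ⟨n₁, hn₁⟩ := hu' ε₁ hε₁
  obtain ⟨n₂, hn₂⟩ := hv' ε₂ hε₂
  rw [← sub_nonpos]
  refine nonpos_of_forall_le_smul (y := |2 • (M * w)|) fun t ht => ?_
  obtain ⟨n₃, hn₃⟩ := hclt t ht
  obtain ⟨n, hn1, hn2, hn3⟩ : ∃ n, n₁ ≤ n ∧ n₂ ≤ n ∧ n₃ ≤ n :=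
    ⟨n₁ ⊔ n₂ ⊔ n₃, le_sup_left.trans le_sup_left, le_sup_right.trans le_sup_left, le_sup_right⟩
  have hle : u + c n • w ≤ v - c n • w := by
    rw [← sub_nonneg]
    refine (smul_nonneg (sub_nonneg.2 (hc2 n)) (add_nonneg hw0 hw0)).trans_eq ?_
    have : v = u + w := by rw [hw]; ring
    rw [this]
    module
  have H := h.sub_le_mul_of_wayLT (u := u + c n • w) (v := v - c n • w) (M := M)
    (huv.of_smul_sub (hc0 n) (by rw [← sub_nonneg]; exact (sub_nonneg.2 hau).trans_eq (by ring)))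
    hle (huv.of_smul_sub (hc0 n)
      (by rw [← sub_nonneg]; exact (sub_nonneg.2 hvb).trans_eq (by ring)))
    (fun z hz => hM z ⟨(hu n).1.trans hz.1, hz.2.trans (hv n).2⟩)
  have h1 := (le_abs_self _).trans (hn₁ n hn1)
  have h2 := (neg_le_abs _).trans (hn₂ n hn2)
  have h3 : -(c n • (2 • (M * w))) ≤ t • |2 • (M * w)| := by
    rw [← smul_neg]
    exact (smul_le_smul_of_nonneg_left (neg_le_abs _) (hc0 n).le).trans
      (smul_le_smul_right_of_nonneg ((hcanti _ _ hn3).trans hn₃.le) (abs_nonneg _))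
  have h4 := add_nonneg (add_nonneg (sub_nonneg.2 H) (sub_nonneg.2 h1))
    (add_nonneg (sub_nonneg.2 h2) (sub_nonneg.2 h3))
  rw [← sub_nonneg]
  refine h4.trans_eq ?_
  have h5 : c n • (2 • (M * w)) = 2 * M * (c n • w) := by
    rw [mul_smul_comm]; congr 1; ring
  rw [h5]
  linear_combination M * hw

/-- Off the support `e` of `v - u` both sides vanish. Replacing `u`, `v` there by `a`, `b`, and `M`
by a global bound of `f`, yields `u' ≪ v'` without changing anything on `e`. -/
theorem sub_le_mul (h : IsOrderPrimitive a b f F) {u v M : E} (hau : a ≤ u)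
    (huv : u ≤ v) (hvb : v ≤ b) (hM : ∀ z ∈ Set.Icc u v, f z ≤ M) :
    F v - F u ≤ M * (v - u) := by
  obtain ⟨e, he, hew, hez⟩ := exists_support_idempotent (sub_nonneg.2 huv)
  have he' := idempotent_one_sub he
  obtain ⟨m, K, hK⟩ := h.bdd
  have hab : a ≤ b := (wayLT_iff.1 h.wayLT).1
  have hu : u ∈ Set.Icc a b := ⟨hau, huv.trans hvb⟩
  have hv : v ∈ Set.Icc a b := ⟨hau.trans huv, hvb⟩
  have hu' := mul_add_one_sub_mul_mem_Icc he hu (Set.left_mem_Icc.2 hab)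
  have hv' := mul_add_one_sub_mul_mem_Icc he hv (Set.right_mem_Icc.2 hab)
  set u' := e * u + (1 - e) * a with hu'_def
  set v' := e * v + (1 - e) * b with hv'_def
  have hsub : v' - u' = e * (v - u) + (1 - e) * (b - a) := by rw [hu'_def, hv'_def]; ring
  have huv' : WayLT u' v' := by
    refine wayLT_iff.2 ⟨?_, fun z hz => ?_⟩
    · rw [← sub_nonneg, hsub]
      exact add_nonneg (mul_nonneg (nonneg_of_idempotent he) (sub_nonneg.2 huv))
        (mul_nonneg (nonneg_of_idempotent he') (sub_nonneg.2 hab))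
    · rw [hsub] at hz
      have h1 := hez z (by
        linear_combination e * hz - z * hew - (z * (v - u) - z * (b - a)) * he)
      have h2 := (wayLT_iff.1 h.wayLT).2 (z * (1 - e)) (by
        linear_combination (1 - e) * hz + (z * (v - u) - z * (b - a)) * he)
      linear_combination h1 + h2
  have hM' : ∀ z ∈ Set.Icc u' v', f z ≤ e * M + (1 - e) * K := by
    intro z hz
    have hzI : z ∈ Set.Icc a b := ⟨hu'.1.trans hz.1, hz.2.trans hv'.2⟩
    have hy : e * z + (1 - e) * u ∈ Set.Icc u v := by
      have he0 := nonneg_of_idempotent he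
      constructor <;> rw [← sub_nonneg]
      · refine (mul_nonneg he0 (sub_nonneg.2 hz.1)).trans_eq ?_
        rw [hu'_def]
        linear_combination (a - u) * he
      · refine (mul_nonneg he0 (sub_nonneg.2 hz.2)).trans_eq ?_
        rw [hv'_def]
        linear_combination (v - b) * he + hew
    have h1 := h.lbp.mul_eq_mul he (x := z) (y := e * z + (1 - e) * u) hzI
      ⟨hau.trans hy.1, hy.2.trans hvb⟩ (by linear_combination (u - z) * he)
    have h2 := add_nonneg (mul_nonneg (nonneg_of_idempotent he) (sub_nonneg.2 (hM _ hy)))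
      (mul_nonneg (nonneg_of_idempotent he') (sub_nonneg.2 (hK z hzI).2))
    rw [← sub_nonneg]
    refine h2.trans_eq ?_
    linear_combination h1
  have H := h.sub_le_mul_of_wayLT_sub hu'.1 huv' hv'.2 hM'
  have h1 := h.lbp'.mul_eq_mul he hu hu' (by rw [hu'_def]; linear_combination (a - u) * he)
  have h2 := h.lbp'.mul_eq_mul he hv hv' (by rw [hv'_def]; linear_combination (b - v) * he)
  have h3 := h.lbp'.mul_eq_mul he' hu hv (by linear_combination hew)
  have h4 := mul_nonneg (nonneg_of_idempotent he) (sub_nonneg.2 H)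
  rw [← sub_nonneg]
  refine h4.trans_eq ?_
  rw [hsub]
  have h5 : e * (e * M + (1 - e) * K) = e * M := by linear_combination (M - K) * he
  have h6 : e * (e * (v - u) + (1 - e) * (b - a)) = e * (v - u) := by
    linear_combination (v - u - (b - a)) * he
  linear_combination (e * (v - u) + (1 - e) * (b - a)) * h5 + M * h6 + M * hew + h2 - h1 - h3

end IsOrderPrimitive

end MeanValue

end PhiAlgebra

namespace PhiAlgebra

/-! ### Darboux sums, subintervals and the integral. -/

section Darboux

variable {E : Type u} [CommRing E] [ConditionallyCompleteLattice E] [IsOrderedAddMonoid E]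
  [Algebra ℝ E] [PosSMulMono ℝ E] [IsFAlgebra E]

theorem OrderBoundedOn.mono {f : E → E} {D D' : Set E} (hf : OrderBoundedOn f D) (h : D' ⊆ D) :
    OrderBoundedOn f D' :=
  let ⟨m, M, H⟩ := hf
  ⟨m, M, fun x hx => H x (h hx)⟩

theorem OrderBoundedOn.bddAbove_image {f : E → E} {D : Set E} (hf : OrderBoundedOn f D) :
    BddAbove (f '' D) :=
  let ⟨_, M, H⟩ := hf
  ⟨M, by rintro _ ⟨x, hx, rfl⟩; exact (H x hx).2⟩

theorem OrderBoundedOn.bddBelow_image {f : E → E} {D : Set E} (hf : OrderBoundedOn f D) :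
    BddBelow (f '' D) :=
  let ⟨m, _, H⟩ := hf
  ⟨m, by rintro _ ⟨x, hx, rfl⟩; exact (H x hx).1⟩

theorem sum_succ_sub_castSucc {n : ℕ} (g : Fin (n + 1) → E) :
    ∑ i : Fin n, (g i.succ - g i.castSucc) = g (Fin.last n) - g 0 := by
  induction n with
  | zero => simp
  | succ n ih =>
    rw [Fin.sum_univ_castSucc]
    have := ih fun i => g i.castSucc
    simp only [Fin.castSucc_zero] at this
    simp only [Fin.succ_castSucc, this, Fin.succ_last]
    abel

/-- On the band of `e`, `[p', q']` lies inside `[p, q]`: a point `z` of the former agrees there with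
`e * z + (1 - e) * p`, a point of the latter. -/
theorem idempotent_mul_sSup_image_le {a b : E} {f : E → E} (hbdd : OrderBoundedOn f (Set.Icc a b))
    (hlbp : LocallyBandPreservingOn f (Set.Icc a b)) {e : E} (he : e * e = e) {p q p' q' : E}
    (hap : a ≤ p) (hpq : p ≤ q) (hqb : q ≤ b) (hap' : a ≤ p') (hpq' : p' ≤ q') (hqb' : q' ≤ b)
    (hp : e * p ≤ e * p') (hq : e * q' ≤ e * q) :
    e * sSup (f '' Set.Icc p' q') ≤ e * sSup (f '' Set.Icc p q) := by
  have he0 := nonneg_of_idempotent he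
  have he1 := nonneg_of_idempotent (idempotent_one_sub he)
  have hI : Set.Icc p q ⊆ Set.Icc a b := Set.Icc_subset_Icc hap hqb
  have hI' : Set.Icc p' q' ⊆ Set.Icc a b := Set.Icc_subset_Icc hap' hqb'
  set M := sSup (f '' Set.Icc p q)
  set M' := sSup (f '' Set.Icc p' q')
  have key : M' ≤ e * M + (1 - e) * M' := by
    refine csSup_le ⟨_, p', Set.left_mem_Icc.2 hpq', rfl⟩ ?_
    rintro _ ⟨z, hz, rfl⟩
    have hy : e * z + (1 - e) * p ∈ Set.Icc p q := by
      constructor <;> rw [← sub_nonneg]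
      · refine (add_nonneg (mul_nonneg he0 (sub_nonneg.2 hz.1)) (sub_nonneg.2 hp)).trans_eq ?_
        ring
      · refine (add_nonneg (add_nonneg (mul_nonneg he0 (sub_nonneg.2 hz.2)) (sub_nonneg.2 hq))
          (mul_nonneg he1 (sub_nonneg.2 hpq))).trans_eq ?_
        ring
    have h1 := hlbp.mul_eq_mul he (hI' hz) (hI hy) (by linear_combination (p - z) * he)
    have h2 : f (e * z + (1 - e) * p) ≤ M :=
      le_csSup (hbdd.mono hI).bddAbove_image ⟨_, hy, rfl⟩
    have h3 : f z ≤ M' := le_csSup (hbdd.mono hI').bddAbove_image ⟨_, hz, rfl⟩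
    rw [← sub_nonneg]
    refine (add_nonneg (mul_nonneg he0 (sub_nonneg.2 h2))
      (mul_nonneg he1 (sub_nonneg.2 h3))).trans_eq ?_
    linear_combination h1
  rw [← sub_nonneg] at key ⊢
  exact key.trans_eq (by ring)

/-- The clamped interval need not lie in `[p, q]`, but it does on the support of its length, and
elsewhere both sides vanish. -/
theorem sSup_image_clamp_mul_le {a b : E} {f : E → E} (hbdd : OrderBoundedOn f (Set.Icc a b))
    (hlbp : LocallyBandPreservingOn f (Set.Icc a b)) {p q l h : E}
    (hap : a ≤ p) (hpq : p ≤ q) (hqb : q ≤ b) (hal : a ≤ l) (hlh : l ≤ h) (hhb : h ≤ b) :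
    sSup (f '' Set.Icc ((p ⊔ l) ⊓ h) ((q ⊔ l) ⊓ h)) * ((q ⊔ l) ⊓ h - (p ⊔ l) ⊓ h) ≤
      sSup (f '' Set.Icc p q) * ((q ⊔ l) ⊓ h - (p ⊔ l) ⊓ h) := by
  have hlp' : l ≤ (p ⊔ l) ⊓ h := le_inf le_sup_right hlh
  have hpq' : (p ⊔ l) ⊓ h ≤ (q ⊔ l) ⊓ h := inf_le_inf_right h (sup_le_sup_right hpq l)
  have hqh' : (q ⊔ l) ⊓ h ≤ h := inf_le_right
  have hpp' : p ⊓ h ≤ (p ⊔ l) ⊓ h := inf_le_inf_right h le_sup_left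
  have hqq' : (q ⊔ l) ⊓ h ≤ q ⊔ l := inf_le_left
  set p' := (p ⊔ l) ⊓ h
  set q' := (q ⊔ l) ⊓ h
  have hd : 0 ≤ q' - p' := sub_nonneg.2 hpq'
  obtain ⟨e, he, hew, hez⟩ := exists_support_idempotent hd
  have he0 := nonneg_of_idempotent he
  have aux : ∀ {x A B : E}, x ≤ A → q' - p' ≤ B → A ⊓ B = 0 → e * x ≤ 0 := by
    intro x A B hx hB hAB
    have hA0 : 0 ≤ A := hAB ▸ inf_le_left
    have h1 : x⁺ * (q' - p') = 0 := le_antisymm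
      ((mul_le_mul (sup_le hx hA0) hB hd hA0).trans_eq (mul_eq_zero_of_inf_eq_zero hAB))
      (mul_nonneg (posPart_nonneg x) hd)
    calc e * x ≤ e * x⁺ := mul_le_mul_of_nonneg_left (le_posPart x) he0
      _ = 0 := by rw [mul_comm]; exact hez _ h1
  have hp : e * p ≤ e * p' := by
    rw [← sub_nonpos, ← mul_sub]
    exact aux (sub_le_sub_left hpp' p) (sub_le_sub hqh' hpp') (by rw [← inf_sub, sub_self])
  have hq : e * q' ≤ e * q := by
    rw [← sub_nonpos, ← mul_sub]
    exact aux (sub_le_sub_right hqq' q) (sub_le_sub hqq' hlp') (by rw [← sub_sup, sub_self])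
  have hM := idempotent_mul_sSup_image_le hbdd hlbp he hap hpq hqb (hal.trans hlp') hpq'
    (hqh'.trans hhb) hp hq
  rw [← hew, ← mul_assoc, ← mul_assoc, mul_comm _ e, mul_comm _ e]
  exact mul_le_mul_of_nonneg_right hM hd

/-- The partition of `[l, h] ⊆ [a, b]` obtained by clamping a partition of `[a, b]`. -/
def OrderPartition.clamp {a b : E} (P : OrderPartition a b) {l h : E} (hal : a ≤ l) (hlh : l ≤ h)
    (hhb : h ≤ b) : OrderPartition l h where
  n := P.n
  pt i := (P.pt i ⊔ l) ⊓ h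
  mono _ _ hij := inf_le_inf_right h (sup_le_sup_right (P.mono hij) l)
  first := by rw [P.first, sup_eq_right.2 hal, inf_eq_left.2 hlh]
  last := by rw [P.last, sup_eq_left.2 (hlh.trans hhb), inf_eq_right.2 hhb]

theorem OrderPartition.mem_Icc {a b : E} (P : OrderPartition a b) (i : Fin (P.n + 1)) :
    P.pt i ∈ Set.Icc a b :=
  ⟨P.first.symm.trans_le (P.mono (Fin.zero_le i)), (P.mono (Fin.le_last i)).trans_eq P.last⟩

theorem OrderPartition.step_le {a b : E} (P : OrderPartition a b) (i : Fin P.n) :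
    P.pt i.castSucc ≤ P.pt i.succ :=
  P.mono i.castSucc_lt_succ.le

/-- The partition of `[a, b]` into one interval. -/
def OrderPartition.single {a b : E} (hab : a ≤ b) : OrderPartition a b where
  n := 1
  pt := ![a, b]
  mono := by
    rw [Fin.monotone_iff_le_succ]
    intro i
    fin_cases i
    exact hab
  first := rfl
  last := rfl

theorem eq_clamp_add_clamp_add_clamp {a b u v x : E} (hx : x ∈ Set.Icc a b) (huv : u ≤ v) :
    (x ⊔ a) ⊓ u + (x ⊔ u) ⊓ v + (x ⊔ v) ⊓ b - u - v = x + ((x ⊔ v) ⊓ b - x ⊔ v) := by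
  rw [sup_eq_left.2 hx.1]
  have h1 := inf_add_sup x u
  have h2 := inf_add_sup (x ⊔ u) v
  rw [sup_assoc, sup_eq_right.2 huv] at h2
  linear_combination h1 + h2

/-- Since `u`, `v` may be incomparable with the points of `P`, they cannot be inserted into the
chain. Clamping replaces insertion: each step of `P` has three clamped pieces whose lengths add up
to its own. -/
theorem upperSum_clamp_le {a b u v : E} {f : E → E} (hbdd : OrderBoundedOn f (Set.Icc a b))
    (hlbp : LocallyBandPreservingOn f (Set.Icc a b)) (P : OrderPartition a b)
    (hau : a ≤ u) (huv : u ≤ v) (hvb : v ≤ b) :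
    upperSum f (P.clamp le_rfl hau (huv.trans hvb)) + upperSum f (P.clamp hau huv hvb) +
      upperSum f (P.clamp (hau.trans huv) hvb le_rfl) ≤ upperSum f P := by
  rw [upperSum, upperSum, upperSum, upperSum]
  change (∑ i : Fin P.n, _) + (∑ i : Fin P.n, _) + (∑ i : Fin P.n, _) ≤ _
  rw [← Finset.sum_add_distrib, ← Finset.sum_add_distrib]
  refine Finset.sum_le_sum fun i _ => ?_
  have hp := P.mem_Icc i.castSucc
  have hq := P.mem_Icc i.succ
  have hpq := P.step_le i
  have key := fun {l h : E} => sSup_image_clamp_mul_le (l := l) (h := h) hbdd hlbp hp.1 hpq hq.2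
  refine (add_le_add (add_le_add (key le_rfl hau (huv.trans hvb)) (key hau huv hvb))
    (key (hau.trans huv) hvb le_rfl)).trans_eq ?_
  have h1 := eq_clamp_add_clamp_add_clamp hp huv
  have h2 := eq_clamp_add_clamp_add_clamp hq huv
  rw [inf_eq_left.2 (sup_le hp.2 hvb)] at h1 ⊢
  rw [inf_eq_left.2 (sup_le hq.2 hvb)] at h2 ⊢
  linear_combination sSup (f '' Set.Icc (P.pt i.castSucc) (P.pt i.succ)) * (h2 - h1)

theorem image_neg_apply (f : E → E) (D : Set E) : (-f) '' D = -(f '' D) := by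
  rw [← Set.image_neg_eq_neg, Set.image_image]
  rfl

theorem upperSum_neg {u v : E} {f : E → E} (hf : OrderBoundedOn f (Set.Icc u v))
    (P : OrderPartition u v) : upperSum (-f) P = -lowerSum f P := by
  rw [upperSum, lowerSum, ← Finset.sum_neg_distrib]
  refine Finset.sum_congr rfl fun i _ => ?_
  rw [image_neg_apply, csSup_neg, neg_mul]
  · exact ⟨_, _, Set.left_mem_Icc.2 (P.step_le i), rfl⟩
  · exact (hf.mono (Set.Icc_subset_Icc (P.mem_Icc _).1 (P.mem_Icc _).2)).bddBelow_image

namespace IsOrderPrimitive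

variable {a b : E} {f F : E → E}

theorem sub_le_upperSum (h : IsOrderPrimitive a b f F) {u v : E} (hau : a ≤ u) (hvb : v ≤ b)
    (P : OrderPartition u v) : F v - F u ≤ upperSum f P := by
  have hsum := sum_succ_sub_castSucc fun i => F (P.pt i)
  rw [P.first, P.last] at hsum
  rw [← hsum]
  refine Finset.sum_le_sum fun i _ => ?_
  have ha := hau.trans (P.mem_Icc i.castSucc).1
  have hb := (P.mem_Icc i.succ).2.trans hvb
  exact h.sub_le_mul ha (P.step_le i) hb fun z hz =>
    le_csSup (h.bdd.mono (Set.Icc_subset_Icc ha hb)).bddAbove_image ⟨z, hz, rfl⟩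

theorem bddBelow_range_upperSum (h : IsOrderPrimitive a b f F) {u v : E} (hau : a ≤ u)
    (hvb : v ≤ b) : BddBelow (Set.range fun P : OrderPartition u v => upperSum f P) :=
  ⟨F v - F u, by rintro _ ⟨P, rfl⟩; exact h.sub_le_upperSum hau hvb P⟩

theorem sub_le_upperIntegral (h : IsOrderPrimitive a b f F) {u v : E} (hau : a ≤ u) (huv : u ≤ v)
    (hvb : v ≤ b) : F v - F u ≤ upperIntegral f u v :=
  le_csInf ⟨_, OrderPartition.single huv, rfl⟩ <| by
    rintro _ ⟨P, rfl⟩; exact h.sub_le_upperSum hau hvb P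

theorem upperIntegral_neg (h : IsOrderPrimitive a b f F) {u v : E} (hau : a ≤ u) (huv : u ≤ v)
    (hvb : v ≤ b) : upperIntegral (-f) u v = -lowerIntegral f u v := by
  have hb := h.bdd.mono (Set.Icc_subset_Icc hau hvb)
  have hne : (Set.range fun P : OrderPartition u v => lowerSum f P).Nonempty :=
    ⟨_, OrderPartition.single huv, rfl⟩
  rw [upperIntegral, lowerIntegral, ← csInf_neg hne]
  · congr 1
    rw [← Set.image_neg_eq_neg, ← Set.range_comp]
    exact congrArg Set.range (funext fun P => upperSum_neg hb P)
  · obtain ⟨m, hm⟩ := h.neg.bddBelow_range_upperSum hau hvb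
    refine ⟨-m, ?_⟩
    rintro _ ⟨P, rfl⟩
    have := hm ⟨P, rfl⟩
    simp only [upperSum_neg hb] at this
    exact le_neg_of_le_neg this

theorem lowerIntegral_le_sub (h : IsOrderPrimitive a b f F) {u v : E} (hau : a ≤ u) (huv : u ≤ v)
    (hvb : v ≤ b) : lowerIntegral f u v ≤ F v - F u := by
  have := h.neg.sub_le_upperIntegral hau huv hvb
  rw [h.upperIntegral_neg hau huv hvb, Pi.neg_apply, Pi.neg_apply, neg_sub_neg, le_neg, neg_sub]
    at this
  exact this

theorem upperIntegral_eq_of_eq (h : IsOrderPrimitive a b f F)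
    (hab : upperIntegral f a b = F b - F a) {u v : E} (hau : a ≤ u) (huv : u ≤ v) (hvb : v ≤ b) :
    upperIntegral f u v = F v - F u := by
  refine le_antisymm ?_ (h.sub_le_upperIntegral hau huv hvb)
  -- On the two outer intervals the mean value bound suffices, so additivity of the integral is not
  -- needed.
  have key : upperIntegral f u v + (F u - F a) + (F b - F v) ≤ upperIntegral f a b := by
    refine le_csInf ⟨_, OrderPartition.single ((hau.trans huv).trans hvb), rfl⟩ ?_
    rintro _ ⟨P, rfl⟩
    refine le_trans ?_ (upperSum_clamp_le h.bdd h.lbp P hau huv hvb)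
    rw [add_comm (upperSum f _) (upperSum f (P.clamp hau huv hvb))]
    exact add_le_add (add_le_add
      (csInf_le (h.bddBelow_range_upperSum hau hvb) ⟨_, rfl⟩)
      (h.sub_le_upperSum le_rfl (huv.trans hvb) _))
      (h.sub_le_upperSum (hau.trans huv) le_rfl _)
  rw [hab] at key
  rw [← sub_nonneg] at key ⊢
  exact key.trans_eq (by ring)

theorem darboux (h : IsOrderPrimitive a b f F) (hint : DarbouxIntegrable f a b)
    {u v : E} (hau : a ≤ u) (huv : u ≤ v) (hvb : v ≤ b) :
    DarbouxIntegrable f u v ∧ darbouxIntegral f u v = F v - F u := by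
  have hab := (wayLT_iff.1 h.wayLT).1
  have h1 := h.sub_le_upperIntegral le_rfl hab le_rfl
  have h2 := h.lowerIntegral_le_sub le_rfl hab le_rfl
  have hU : upperIntegral f a b = F b - F a := le_antisymm (hint.2.trans_le h2) h1
  have hL : upperIntegral (-f) a b = (-F) b - (-F) a := by
    rw [h.upperIntegral_neg le_rfl hab le_rfl, ← hint.2, hU]
    simp only [Pi.neg_apply]
    abel
  have hU' := h.upperIntegral_eq_of_eq hU hau huv hvb
  have hL' := h.neg.upperIntegral_eq_of_eq hL hau huv hvb
  rw [h.upperIntegral_neg hau huv hvb, Pi.neg_apply, Pi.neg_apply, neg_sub_neg, neg_eq_iff_eq_neg,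
    neg_sub] at hL'
  exact ⟨⟨h.bdd.mono (Set.Icc_subset_Icc hau hvb), hU'.trans hL'.symm⟩, hL'⟩

theorem integralFromTo_eq (h : IsOrderPrimitive a b f F) (hint : DarbouxIntegrable f a b)
    {x y : E} (hx : x ∈ Set.Icc a b) (hy : y ∈ Set.Icc a b) :
    IntegrableFromTo f x y ∧ integralFromTo f x y = F y - F x := by
  have hinf : x ⊓ y ∈ Set.Icc a b := ⟨le_inf hx.1 hy.1, inf_le_left.trans hx.2⟩
  have hsup : x ⊔ y ∈ Set.Icc a b := ⟨hx.1.trans le_sup_left, sup_le hx.2 hy.2⟩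
  obtain ⟨h1, h2⟩ := h.darboux hint hinf.1 inf_le_sup hsup.2
  refine ⟨h1, ?_⟩
  obtain ⟨e, he, hew, hez⟩ := exists_support_idempotent (posPart_nonneg (y - x))
  obtain ⟨g, hg, hgw, hgz⟩ := exists_support_idempotent (posPart_nonneg (x - y))
  rw [integralFromTo, bandLT_eq_idempotentBand he hew hez, bandLT_eq_idempotentBand hg hgw hgz,
    bandProj_idempotentBand he, bandProj_idempotentBand hg, h2]
  obtain ⟨e1, e2⟩ := support_mul_sup hew hez
  obtain ⟨g1, g2⟩ := support_mul_sup hgw hgz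
  rw [sup_comm] at g1 g2
  have hs := inf_add_sup x y
  have heg : e * g = 0 := by
    refine hgz _ ?_
    rw [mul_comm]
    refine hez _ (mul_eq_zero_of_inf_eq_zero ?_)
    have := posPart_inf_negPart_eq_zero (x - y)
    rwa [negPart_def, neg_sub, ← posPart_def] at this
  -- The third idempotent carries the band where `x = y`, hence `F x = F y`.
  have hk : (1 - e - g) * (1 - e - g) = 1 - e - g := by
    linear_combination he + hg + 2 * heg
  have E1 := h.lbp'.mul_eq_mul he hsup hy e1
  have E2 := h.lbp'.mul_eq_mul he hinf hx (by linear_combination e * hs - e1)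
  have G1 := h.lbp'.mul_eq_mul hg hsup hx g1
  have G2 := h.lbp'.mul_eq_mul hg hinf hy (by linear_combination g * hs - g1)
  have K := h.lbp'.mul_eq_mul hk hx hy (by
    linear_combination g1 + g2 - e1 - e2)
  linear_combination E1 - E2 - G1 + G2 + K

end IsOrderPrimitive

end Darboux

end PhiAlgebra

theorem theoremt {E : Type u} [Ring E] [ConditionallyCompleteLattice E] [IsOrderedAddMonoid E]
    [Algebra ℝ E] [PosSMulMono ℝ E] [IsFAlgebra E]
    (a b : E) (hab : WayLT a b)
    (f F : E → E)
    (hf_bdd : OrderBoundedOn f (Set.Icc a b))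
    (hf_lbp : LocallyBandPreservingOn f (Set.Icc a b))
    (hF_cont : OrderContinuousOn F (Set.Icc a b))
    (hF_deriv : ∀ c ∈ openInterval a b, HasOrderDerivAt F (Set.Icc a b) c (f c))
    (hF_lbp : LocallyBandPreservingOn F (Set.Icc a b))
    (hf_int : DarbouxIntegrable f a b) :
    ∀ x ∈ Set.Icc a b, ∀ y ∈ Set.Icc a b,
      IntegrableFromTo f x y ∧ integralFromTo f x y = F y - F x := by
  -- This extends the given ring structure, so all the definitions keep their meaning.
  let _ : CommRing E := { ‹Ring E› with mul_comm := mul_comm_of_isFAlgebra }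
  have h : IsOrderPrimitive a b f F := ⟨hab, hf_bdd, hf_lbp, hF_cont, hF_deriv, hF_lbp⟩
  exact fun x hx y hy => h.integralFromTo_eq hf_int hx hy
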